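/- Let $\tau$ be any linearly ordered set (any order type), and let $\tau^*$ be $\tau$ with the reversed order. Let $\Gamma=\sum_{\tau^*}\mathbb{Q}$ be the concatenation of $\tau^*$ copies of $\mathbb{Q}$ (that is, $\tau^*\times\mathbb{Q}$ ordered lexicographically, $\tau^*$ first), and let $\sigma_\Gamma$ be the automorphism of the chain $\Gamma$ that is translation by $-1$ on every copy of $\mathbb{Q}$. Let $G=\mathbf{H}_\Gamma\mathbb{R}$ be the Hahn group over $\Gamma$ (formal sums $\sum g_\gamma 1_\gamma$, $g_\gamma\in\mathbb{R}$, with well-ordered support, ordered lexicographically), and let $K=\mathbb{R}((G))$ be the ordered field of generalized power series $\sum s_g t^g$, $s_g\in\mathbb{R}$, with well-ordered support in $G$, ordered lexicographically. For an ordered field $F$, let $v$ be its natural valuation, whose valuation ring $R_v$ is the convex hull of $\mathbb{Q}$ in $F$, and put $\mathbf{P}_F=F^{>0}\setminus R_v$. For an order preserving field automorphism $\sigma$ of $F$, a convex valuation $w\neq v$ of $F$ (one whose valuation ring $R_w$ is convex and different from $R_v$) is called $\sigma$-compatible if $w(a)\le w(b)\iff w(\sigma(a))\le w(\sigma(b))$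 for all $a,b\in F$. The principal difference rank $\mathcal{R}^{\rm pr}_\sigma$ of $(F,\sigma)$ is the set, ordered by inclusion, of those $R_w$ for which there is $a\in\mathbf{P}_F$ such that $R_w$ is the smallest of the $\sigma$-compatible convex valuation rings $\ne R_v$ containing $a$. The automorphism $\sigma$ is $\omega$-increasing if $\sigma(a)>a^n$ for all integers $n\ge 0$ and all $a\in\mathbf{P}_F$. The ordered field $F$ is maximally valued if $(F,v)$ has no proper immediate valued field extension (an extension with the same value group and the same residue field). Then there are an order preserving automorphism $\sigma_G$ of the group $G$ and an order preserving automorphism $\sigma$ of the field $K$ with $$\sigma_G\Big(\sum_\gamma g_\gamma 1_\gamma\Big)=\sum_\gamma g_\gamma 1_{\sigma_\Gamma(\gamma)},\qquad \sigma\Big(\sum_g s_g t^g\Big)=\sum_g s_g t^{\sigma_G(g)},$$ such that $K$ is maximally valued, $\sigma$ is $\omega$-increasing, and the principal difference rank $\mathcal{R}^{\rm pr}_\sigma$ of $(K,\sigma)$ has order type $\tau$. If $\tau$ is non-empty, then moreover $K$ is non-archimedean and $\sigma$ is not the identity. In particular, for every order type $\tau$ there is a maximally valued ordered field with an $\omega$-increasing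 automorphism whose principal difference rank has order type $\tau$. -/

import Mathlib

universe u w

/-! ### The natural valuation and the (difference) rank of an ordered field -/

section Rank

variable (K : Type*) [Field K] [LinearOrder K] [IsStrictOrderedRing K]

/-- The valuation ring of the natural valuation of the ordered field `K`: the convex hull of `ℚ`
in `K`. -/
def naturalRing : ValuationSubring K where
  carrier := {x | ∃ p q : ℚ, (p : K) ≤ x ∧ x ≤ (q : K)}
  zero_mem' := ⟨0, 0, by simp, by simp⟩
  one_mem' := ⟨1, 1, by simp, by simp⟩
  add_mem' := by
    rintro x y ⟨p, q, hp, hq⟩ ⟨p', q', hp', hq'⟩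
    exact ⟨p + p', q + q', by push_cast; linarith, by push_cast; linarith⟩
  neg_mem' := by
    rintro x ⟨p, q, hp, hq⟩
    exact ⟨-q, -p, by push_cast; linarith, by push_cast; linarith⟩
  mul_mem' := by
    rintro x y ⟨p, q, hp, hq⟩ ⟨p', q', hp', hq'⟩
    have h1 : |x| ≤ ((|p| + |q| : ℚ) : K) := by
      push_cast
      rw [abs_le]
      constructor
      · linarith [neg_abs_le (p : K), abs_nonneg (q : K)]
      · linarith [le_abs_self (q : K), abs_nonneg (p : K)]
    have h2 : |y| ≤ ((|p'| + |q'| : ℚ) : K) := by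
      push_cast
      rw [abs_le]
      constructor
      · linarith [neg_abs_le (p' : K), abs_nonneg (q' : K)]
      · linarith [le_abs_self (q' : K), abs_nonneg (p' : K)]
    have h3 : |x * y| ≤ (((|p| + |q|) * (|p'| + |q'|) : ℚ) : K) := by
      rw [abs_mul, Rat.cast_mul]
      exact mul_le_mul h1 h2 (abs_nonneg _) ((abs_nonneg _).trans h1)
    refine ⟨-((|p| + |q|) * (|p'| + |q'|)), (|p| + |q|) * (|p'| + |q'|), ?_, (abs_le.mp h3).2⟩
    rw [Rat.cast_neg]
    exact (abs_le.mp h3).1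
  mem_or_inv_mem' := by
    intro x
    rcases le_total |x| 1 with h | h
    · left
      exact ⟨-1, 1, by simpa using (abs_le.mp h).1, by simpa using (abs_le.mp h).2⟩
    · right
      have h' : |x⁻¹| ≤ 1 := by
        rw [abs_inv]
        exact inv_le_one_of_one_le₀ h
      exact ⟨-1, 1, by simpa using (abs_le.mp h').1, by simpa using (abs_le.mp h').2⟩

/-- The set `P_K` of positive infinite elements of `K`. -/
def posInfinite : Set K := {a | 0 < a ∧ a ∉ naturalRing K}

/-- The rank of the ordered field `K`: the set of all valuation rings of convex valuations other
than the natural one. It is ordered by inclusion. -/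
def convexRank : Set (ValuationSubring K) :=
  {A | (A : Set K).OrdConnected ∧ A ≠ naturalRing K}

variable {K}

/-- The valuation `w` with valuation ring `A` is `σ`-compatible:
`w a ≤ w b ↔ w (σ a) ≤ w (σ b)` for all `a`, `b`. -/
def IsDifferenceCompatible (σ : K ≃+*o K) (A : ValuationSubring K) : Prop :=
  ∀ a b : K, A.valuation a ≤ A.valuation b ↔ A.valuation (σ a) ≤ A.valuation (σ b)

/-- The `σ`-rank of `(K, <, σ)`. -/
def differenceRank (σ : K ≃+*o K) : Set (ValuationSubring K) :=
  {A | A ∈ convexRank K ∧ IsDifferenceCompatible σ A}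

/-- The principal `σ`-rank of `(K, <, σ)`: the rings that are, for some `a ∈ P_K`, the smallest
convex `σ`-compatible subring containing `a`. It is ordered by inclusion. -/
def principalDifferenceRank (σ : K ≃+*o K) : Set (ValuationSubring K) :=
  {A | ∃ a ∈ posInfinite K, IsLeast {B | B ∈ differenceRank σ ∧ a ∈ B} A}

/-- `σ` is `ω`-increasing: `σ a > a ^ n` for all `n` and all `a ∈ P_K`. -/
def IsOmegaIncreasing (σ : K ≃+*o K) : Prop :=
  ∀ n : ℕ, ∀ a ∈ posInfinite K, a ^ n < σ a

end Rank

/-! ### Maximally valued fields -/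

section Maximal

/-- The valued field `(L, B)` is an immediate extension of the valued field `(K, A)`: the ring `B`
lies over `A`, and the two have the same value group and the same residue field. -/
structure IsImmediateExtension {K L : Type*} [Field K] [Field L] [Algebra K L]
    (A : ValuationSubring K) (B : ValuationSubring L) : Prop where
  comap_eq : B.comap (algebraMap K L) = A
  value : ∀ x : L, ∃ y : K, B.valuation (algebraMap K L y) = B.valuation x
  residue : ∀ x ∈ B, ∃ y ∈ A, B.valuation (x - algebraMap K L y) < 1


/-- The valued field `(K, A)` is maximally valued: it has no proper immediate extension. -/
def IsMaximallyValued {K : Type u} [Field K] (A : ValuationSubring K) : Prop :=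
  ∀ (L : Type w) [Field L] [Algebra K L] (B : ValuationSubring L),
    IsImmediateExtension A B → Function.Surjective (algebraMap K L)

end Maximal

/-! ### Hahn groups, Hahn fields and the concatenation of copies of `ℚ` -/

section Hahn

/-- The Hahn group `H_Γ ℝ` over the chain `Γ`, ordered lexicographically. -/
abbrev HahnGroup (Γ : Type*) [LinearOrder Γ] : Type _ := Lex (HahnSeries Γ ℝ)

/-- The Hahn field `ℝ((G))` over the ordered abelian group `G`, ordered lexicographically. -/
abbrev HahnField (G : Type*) [AddCommGroup G] [LinearOrder G] [IsOrderedAddMonoid G] : Type _ :=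
  Lex (HahnSeries G ℝ)

/-- The concatenation of `τ*` copies of `ℚ`. -/
abbrev RatChain (τ : Type*) [LinearOrder τ] : Type _ := τᵒᵈ ×ₗ ℚ

/-- The automorphism of the chain `RatChain τ` that is the translation by `-1` on every copy
of `ℚ`. -/
def ratChainShift (τ : Type*) [LinearOrder τ] : RatChain τ ≃o RatChain τ where
  toFun γ := toLex ((ofLex γ).1, (ofLex γ).2 - 1)
  invFun γ := toLex ((ofLex γ).1, (ofLex γ).2 + 1)
  left_inv γ := by simp
  right_inv γ := by simp
  map_rel_iff' := by
    intro a b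
    simp [Prod.Lex.le_iff]

end Hahn

/-! A smaller exponent dominates: in `G` the least point of the support decides the size, and in `K`
elements of negative order are infinite. The shift lowers every point of `Γ`, so a negative `g` is
sent below all `n • g`, and an infinite `a` of order `g` is sent above all `a ^ n`. This is
`ω`-increase.

Let `a` be infinite, with order `g < 0` whose leading point lies in the copy with index `x`. A
compatible convex ring containing `a` contains its iterated shifts, whose orders have leading points
coinitial in that copy. By convexity it contains every series whose order is bounded below by some
group element supported on copies of index at most `x` in `τ`. These series already form a
compatible ring, so the least ring depends only on `x`, and it grows strictly with `x` because the
copies are arranged along the reversed order (`isLeast_ringOfSubgroup_initialSubgroup`,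
`ringOfSubgroup_initialSubgroup_le_iff`).

Maximality is proved directly: an element `x` of an immediate extension determines the coefficients
of a Hahn series `y` through its approximants. If `x ≠ y`, the leading term of `x - y` would be a
further coefficient that `y` has missed (`isMaximallyValued_hahnField`). -/

open HahnSeries

/-! ### Maps induced by isomorphisms of the exponents -/

section Congr

/-- The isomorphism of lexicographically ordered groups of Hahn series that is induced by an
isomorphism of the chains of exponents. -/
noncomputable def hahnGroupCongr {Γ Γ' : Type*} [LinearOrder Γ] [LinearOrder Γ'] (e : Γ ≃o Γ') :
    HahnGroup Γ ≃+o HahnGroup Γ' where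
  toFun x := toLex (embDomain e.toOrderEmbedding (ofLex x))
  invFun x := toLex (embDomain e.symm.toOrderEmbedding (ofLex x))
  left_inv x := by
    refine ofLex.injective (HahnSeries.ext (funext fun a => ?_))
    have h := embDomain_coeff (f := e.symm.toOrderEmbedding)
      (x := embDomain e.toOrderEmbedding (ofLex x)) (a := e a)
    have h' := embDomain_coeff (f := e.toOrderEmbedding) (x := ofLex x) (a := a)
    have he : e.symm.toOrderEmbedding (e a) = a := e.symm_apply_apply a
    rw [he] at h
    exact h.trans h'
  right_inv x := by
    refine ofLex.injective (HahnSeries.ext (funext fun a => ?_))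
    have h := embDomain_coeff (f := e.toOrderEmbedding)
      (x := embDomain e.symm.toOrderEmbedding (ofLex x)) (a := e.symm a)
    have h' := embDomain_coeff (f := e.symm.toOrderEmbedding) (x := ofLex x) (a := a)
    have he : e.toOrderEmbedding (e.symm a) = a := e.apply_symm_apply a
    rw [he] at h
    exact h.trans h'
  map_add' x y := congrArg toLex (embDomain_add e.toOrderEmbedding (ofLex x) (ofLex y))
  map_le_map_iff' {x y} := (embDomainOrderEmbedding e.toOrderEmbedding (R := ℝ)).le_iff_le

theorem coeff_hahnGroupCongr {Γ Γ' : Type*} [LinearOrder Γ] [LinearOrder Γ'] (e : Γ ≃o Γ')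
    (x : HahnGroup Γ) (a : Γ) : (ofLex (hahnGroupCongr e x)).coeff (e a) = (ofLex x).coeff a :=
  embDomain_coeff (f := e.toOrderEmbedding)

theorem orderTop_hahnGroupCongr {Γ Γ' : Type*} [LinearOrder Γ] [LinearOrder Γ'] (e : Γ ≃o Γ')
    (x : HahnGroup Γ) : (ofLex (hahnGroupCongr e x)).orderTop = (ofLex x).orderTop.map e :=
  orderTop_embDomain (f := e.toOrderEmbedding)

variable {G G' : Type*} [AddCommGroup G] [LinearOrder G] [IsOrderedAddMonoid G]
  [AddCommGroup G'] [LinearOrder G'] [IsOrderedAddMonoid G']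

/-- The isomorphism of Hahn fields that is induced by an isomorphism of the ordered groups of
exponents. -/
noncomputable def hahnFieldCongr (e : G ≃+o G') : HahnField G ≃+*o HahnField G' where
  toFun := hahnGroupCongr (e : G ≃o G')
  invFun := (hahnGroupCongr (e : G ≃o G')).symm
  left_inv := (hahnGroupCongr (e : G ≃o G')).left_inv
  right_inv := (hahnGroupCongr (e : G ≃o G')).right_inv
  map_add' := map_add (hahnGroupCongr (e : G ≃o G'))
  map_mul' x y := congrArg toLex
    (embDomain_mul (e : G ≃o G').toOrderEmbedding (map_add e) (ofLex x) (ofLex y))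
  map_le_map_iff' := (hahnGroupCongr (e : G ≃o G')).map_le_map_iff'

theorem coeff_hahnFieldCongr (e : G ≃+o G') (s : HahnField G) (g : G) :
    (ofLex (hahnFieldCongr e s)).coeff (e g) = (ofLex s).coeff g :=
  coeff_hahnGroupCongr (e : G ≃o G') s g

theorem orderTop_hahnFieldCongr (e : G ≃+o G') (s : HahnField G) :
    (ofLex (hahnFieldCongr e s)).orderTop = (ofLex s).orderTop.map e :=
  orderTop_hahnGroupCongr (e : G ≃o G') s

end Congr

/-! ### Convex valuation rings of a Hahn field -/

section Rings

theorem neg_lt_of_orderTop_lt {Γ : Type*} [LinearOrder Γ] {g h : HahnGroup Γ} (hg : g < 0)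
    (h' : (ofLex g).orderTop < (ofLex h).orderTop) : g < h := by
  have := abs_lt_abs_of_orderTop_ofLex h'
  rw [abs_of_neg hg] at this
  exact (lt_neg.mp this).trans_le (neg_abs_le h)

variable {G : Type*} [AddCommGroup G] [LinearOrder G] [IsOrderedAddMonoid G]

theorem orderTop_one_hahnField : (ofLex (1 : HahnField G)).orderTop = 0 :=
  orderTop_one

/-- Being bounded by an integer is a comparison of archimedean classes with `1`; as `ℝ` is
archimedean, leading coefficients do not affect it. -/
theorem mem_naturalRing_iff {s : HahnField G} :
    s ∈ naturalRing (HahnField G) ↔ 0 ≤ (ofLex s).orderTop := by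
  have h1 : s ∈ naturalRing (HahnField G) ↔
      ArchimedeanClass.mk (1 : HahnField G) ≤ ArchimedeanClass.mk s := by
    rw [ArchimedeanClass.mk_le_mk]
    constructor
    · rintro ⟨p, q, hp, hq⟩
      obtain ⟨n, hn⟩ := exists_nat_ge (max (-p) q)
      refine ⟨n, ?_⟩
      have hp' : ((-p : ℚ) : HahnField G) ≤ ((n : ℚ) : HahnField G) :=
        Rat.cast_le.mpr ((le_max_left _ _).trans hn)
      have hq' : ((q : ℚ) : HahnField G) ≤ ((n : ℚ) : HahnField G) :=
        Rat.cast_le.mpr ((le_max_right _ _).trans hn)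
      push_cast at hp' hq'
      rw [abs_one, nsmul_eq_mul, mul_one, abs_le]
      constructor <;> linarith
    · rintro ⟨n, hn⟩
      rw [abs_one, nsmul_eq_mul, mul_one, abs_le] at hn
      exact ⟨-n, n, by push_cast; exact hn.1, by push_cast; exact hn.2⟩
  rw [h1, archimedeanClassMk_le_archimedeanClassMk_iff, orderTop_one_hahnField,
    le_iff_lt_or_eq (a := (0 : WithTop G))]
  refine or_congr_right ⟨fun h => h.1, fun h => ⟨h, ?_⟩⟩
  have hs : ofLex s ≠ 0 := by
    rw [← orderTop_ne_top, ← h]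
    exact WithTop.zero_ne_top
  exact (ArchimedeanClass.mk_eq_mk_of_archimedean (by simp) (leadingCoeff_ne_zero.mpr hs)).le

theorem mem_posInfinite_iff {s : HahnField G} :
    s ∈ posInfinite (HahnField G) ↔ 0 < s ∧ (ofLex s).orderTop < 0 := by
  rw [← not_le (a := (0 : WithTop G)), ← mem_naturalRing_iff]
  rfl

theorem exists_orderTop_eq_of_mem_posInfinite {s : HahnField G}
    (hs : s ∈ posInfinite (HahnField G)) : ∃ g : G, (ofLex s).orderTop = g ∧ g < 0 := by
  have h := (mem_posInfinite_iff.mp hs).2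
  obtain ⟨g, hg⟩ := WithTop.ne_top_iff_exists.mp h.ne_top
  rw [← hg] at h
  exact ⟨g, hg.symm, WithTop.coe_lt_coe.mp h⟩

theorem single_mem_posInfinite {g : G} (hg : g < 0) :
    (toLex (single g (1 : ℝ)) : HahnField G) ∈ posInfinite (HahnField G) := by
  rw [mem_posInfinite_iff, ← leadingCoeff_pos_iff, ofLex_toLex, leadingCoeff_of_single,
    orderTop_single one_ne_zero]
  exact ⟨one_pos, WithTop.coe_lt_coe.mpr hg⟩

/-- The valuation ring of the convex hull of a subgroup `H` of the value group of a Hahn field. -/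
def ringOfSubgroup (H : AddSubgroup G) : ValuationSubring (HahnField G) where
  carrier := {s | ∃ h ∈ H, (h : WithTop G) ≤ (ofLex s).orderTop}
  zero_mem' := ⟨0, H.zero_mem, by simp⟩
  one_mem' := ⟨0, H.zero_mem, by rw [orderTop_one_hahnField]; rfl⟩
  add_mem' := by
    rintro s t ⟨g, hg, hs⟩ ⟨h, hh, ht⟩
    refine ⟨min g h, ?_, ?_⟩
    · rcases min_choice g h with e | e <;> rwa [e]
    · refine le_trans ?_ min_orderTop_le_orderTop_add
      rw [WithTop.coe_min]
      exact min_le_min hs ht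
  neg_mem' := by
    rintro s ⟨g, hg, hs⟩
    exact ⟨g, hg, by rwa [ofLex_neg, orderTop_neg]⟩
  mul_mem' := by
    rintro s t ⟨g, hg, hs⟩ ⟨h, hh, ht⟩
    refine ⟨g + h, H.add_mem hg hh, ?_⟩
    rw [ofLex_mul, orderTop_mul, WithTop.coe_add]
    exact add_le_add hs ht
  mem_or_inv_mem' := by
    intro s
    rcases eq_or_ne s 0 with rfl | hs
    · exact Or.inl ⟨0, H.zero_mem, by simp⟩
    rcases le_or_gt 0 (ofLex s).orderTop with h | h
    · exact Or.inl ⟨0, H.zero_mem, h⟩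
    · refine Or.inr ⟨0, H.zero_mem, ?_⟩
      by_contra! h'
      have h1 : (ofLex (s * s⁻¹)).orderTop = 0 := by
        rw [mul_inv_cancel₀ hs, orderTop_one_hahnField]
      rw [ofLex_mul, orderTop_mul] at h1
      obtain ⟨a, ha⟩ := WithTop.ne_top_iff_exists.mp h.ne_top
      obtain ⟨b, hb⟩ := WithTop.ne_top_iff_exists.mp h'.ne_top
      rw [← ha] at h h1
      rw [← hb] at h' h1
      have h2 := WithTop.coe_lt_coe.mp h
      have h3 := WithTop.coe_lt_coe.mp h'
      exact (add_neg h2 h3).ne (WithTop.coe_injective h1)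

theorem mem_ringOfSubgroup {H : AddSubgroup G} {s : HahnField G} :
    s ∈ ringOfSubgroup H ↔ ∃ h ∈ H, (h : WithTop G) ≤ (ofLex s).orderTop :=
  Iff.rfl

theorem single_mem_ringOfSubgroup_iff {H : AddSubgroup G} {g : G} :
    (toLex (single g (1 : ℝ)) : HahnField G) ∈ ringOfSubgroup H ↔ ∃ h ∈ H, h ≤ g := by
  simp [mem_ringOfSubgroup, orderTop_single]

theorem orderTop_le_of_abs_le {s t : HahnField G} (h : |s| ≤ |t|) :
    (ofLex t).orderTop ≤ (ofLex s).orderTop :=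
  le_of_not_gt fun h' => h.not_gt (abs_lt_abs_of_orderTop_ofLex h')

theorem ordConnected_ringOfSubgroup (H : AddSubgroup G) :
    (ringOfSubgroup H : Set (HahnField G)).OrdConnected := by
  refine ⟨?_⟩
  rintro a ⟨g, hg, ha⟩ b ⟨h, hh, hb⟩ c ⟨hac, hcb⟩
  rcases le_total |a| |b| with hab | hab
  · exact ⟨h, hh, hb.trans (orderTop_le_of_abs_le
      ((abs_le_max_abs_abs hac hcb).trans (max_le hab le_rfl)))⟩
  · exact ⟨g, hg, ha.trans (orderTop_le_of_abs_le
      ((abs_le_max_abs_abs hac hcb).trans (max_le le_rfl hab)))⟩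

theorem ringOfSubgroup_mem_convexRank {H : AddSubgroup G} {g : G} (hg : g < 0) (hH : g ∈ H) :
    ringOfSubgroup H ∈ convexRank (HahnField G) := by
  refine ⟨ordConnected_ringOfSubgroup H, fun h => (single_mem_posInfinite hg).2 ?_⟩
  rw [← h]
  exact single_mem_ringOfSubgroup_iff.mpr ⟨g, hH, le_rfl⟩

/-- Comparing values means divisibility in `A`, so a map preserving `A` preserves the comparison. -/
theorem isDifferenceCompatible_of_mem_iff {K : Type*} [Field K] [LinearOrder K]
    [IsStrictOrderedRing K] {σ : K ≃+*o K} {A : ValuationSubring K}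
    (h : ∀ s, σ s ∈ A ↔ s ∈ A) : IsDifferenceCompatible σ A := by
  intro a b
  rw [A.valuation_le_iff, A.valuation_le_iff]
  constructor
  · rintro ⟨c, rfl⟩
    exact ⟨⟨σ c, (h c).mpr c.2⟩, (map_mul σ _ _).symm⟩
  · rintro ⟨c, hc⟩
    obtain ⟨d, hd⟩ : ∃ d, σ d = c := σ.surjective c
    refine ⟨⟨d, (h d).mp (hd ▸ c.2)⟩, σ.injective ?_⟩
    change σ (d * b) = σ a
    rw [map_mul, hd, hc]

theorem IsDifferenceCompatible.mem_iff {K : Type*} [Field K] [LinearOrder K]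
    [IsStrictOrderedRing K] {σ : K ≃+*o K} {A : ValuationSubring K}
    (h : IsDifferenceCompatible σ A) (s : K) : σ s ∈ A ↔ s ∈ A := by
  have := h s 1
  rw [map_one σ, map_one, A.valuation_le_one_iff, A.valuation_le_one_iff] at this
  exact this.symm

theorem isDifferenceCompatible_ringOfSubgroup {e : G ≃+o G} {H : AddSubgroup G}
    (hH : ∀ g, e g ∈ H ↔ g ∈ H) :
    IsDifferenceCompatible (hahnFieldCongr e) (ringOfSubgroup H) := by
  refine isDifferenceCompatible_of_mem_iff fun s => ?_
  rw [mem_ringOfSubgroup, mem_ringOfSubgroup, orderTop_hahnFieldCongr]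
  generalize (ofLex s).orderTop = o
  induction o with
  | top => simp
  | coe g =>
    simp only [WithTop.map_coe, WithTop.coe_le_coe]
    constructor
    · rintro ⟨h, hh, hg⟩
      obtain ⟨h, rfl⟩ := e.surjective h
      exact ⟨h, (hH h).mp hh, (map_le_map_iff e).mp hg⟩
    · rintro ⟨h, hh, hg⟩
      exact ⟨e h, (hH h).mpr hh, (map_le_map_iff e).mpr hg⟩

end Rings

/-! ### Hahn fields are maximally valued -/

section Maximal

variable {G : Type*} [AddCommGroup G] [LinearOrder G] [IsOrderedAddMonoid G]

theorem ofLex_single_mul_coeff (g : G) (y : HahnField G) :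
    (ofLex (toLex (single g (1 : ℝ)) * y : HahnField G)).coeff g = (ofLex y).coeff 0 := by
  rw [ofLex_mul, ofLex_toLex, coeff_single_mul, one_mul, sub_self]

variable {L : Type*} [Field L] [Algebra (HahnField G) L] {B : ValuationSubring L}

/-- Since `B` lies over the natural ring, the case `t = 1` is membership in that ring; dividing by
`t` reduces to it. -/
theorem valuation_algebraMap_le_iff
    (hB : IsImmediateExtension (naturalRing (HahnField G)) B) {s t : HahnField G} :
    B.valuation (algebraMap _ L s) ≤ B.valuation (algebraMap _ L t) ↔
      (ofLex t).orderTop ≤ (ofLex s).orderTop := by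
  have key : ∀ u : HahnField G, B.valuation (algebraMap _ L u) ≤ 1 ↔ 0 ≤ (ofLex u).orderTop := by
    intro u
    rw [B.valuation_le_one_iff, ← mem_naturalRing_iff, ← hB.comap_eq]
    rfl
  rcases eq_or_ne t 0 with rfl | ht
  · simp
  obtain ⟨u, rfl⟩ : ∃ u, s = u * t := ⟨s * t⁻¹, by field_simp⟩
  have hv : 0 < B.valuation (algebraMap _ L t) := by
    rw [zero_lt_iff, Valuation.ne_zero_iff]
    exact (map_ne_zero _).mpr ht
  rw [map_mul, map_mul, mul_le_iff_le_one_left hv, key, ofLex_mul, orderTop_mul]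
  obtain ⟨g, hg⟩ := WithTop.ne_top_iff_exists.mp (orderTop_ne_top.mpr (show ofLex t ≠ 0 from ht))
  rw [← hg]
  generalize (ofLex u).orderTop = o
  induction o with
  | top => simp
  | coe h => norm_cast; simp

theorem valuation_algebraMap_lt_single_iff
    (hB : IsImmediateExtension (naturalRing (HahnField G)) B) {s : HahnField G} {g : G} :
    B.valuation (algebraMap _ L s) < B.valuation (algebraMap _ L (toLex (single g (1 : ℝ)))) ↔
      ∀ h ≤ g, (ofLex s).coeff h = 0 := by
  rw [← not_le, valuation_algebraMap_le_iff hB, ofLex_toLex, orderTop_single one_ne_zero, not_le]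
  constructor
  · exact fun h i hi => coeff_eq_zero_of_lt_orderTop ((WithTop.coe_le_coe.mpr hi).trans_lt h)
  · intro h
    by_contra! h'
    obtain ⟨i, hi⟩ := WithTop.ne_top_iff_exists.mp (h'.trans_lt (WithTop.coe_lt_top g)).ne
    exact coeff_orderTop_ne hi.symm (h i (by rw [← hi] at h'; exact WithTop.coe_le_coe.mp h'))

variable (B) in
/-- The elements of the Hahn field whose distance to `x` has value larger than `g`. -/
def approximants (x : L) (g : G) : Set (HahnField G) :=
  {y | B.valuation (x - algebraMap _ L y) <
    B.valuation (algebraMap (HahnField G) L (toLex (single g (1 : ℝ))))}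

theorem coeff_eq_of_mem_approximants
    (hB : IsImmediateExtension (naturalRing (HahnField G)) B) {x : L} {g h : G}
    {y z : HahnField G} (hy : y ∈ approximants B x g) (hz : z ∈ approximants B x g)
    (hh : h ≤ g) : (ofLex y).coeff h = (ofLex z).coeff h := by
  have h1 : B.valuation (algebraMap _ L (y - z)) <
      B.valuation (algebraMap (HahnField G) L (toLex (single g (1 : ℝ)))) := by
    have e : algebraMap _ L (y - z) = (x - algebraMap _ L z) - (x - algebraMap _ L y) := by
      rw [map_sub]; ring
    rw [e]
    exact B.valuation.map_sub_lt hz hy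
  have h2 := (valuation_algebraMap_lt_single_iff hB).mp h1 h hh
  rwa [ofLex_sub, coeff_sub, sub_eq_zero] at h2

theorem approximants_anti
    (hB : IsImmediateExtension (naturalRing (HahnField G)) B) {x : L} {g h : G} (hh : h ≤ g) :
    approximants B x g ⊆ approximants B x h := fun y hy => by
  refine lt_of_lt_of_le hy ((valuation_algebraMap_le_iff hB).mpr ?_)
  simpa [orderTop_single] using hh

open Classical in
/-- The coefficients of the Hahn series that agrees with all approximants of `x`. -/
noncomputable def limitCoeff (B : ValuationSubring L) (x : L) (g : G) : ℝ :=
  -- With the default `0`, a point of the support always has an approximant.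
  if h : (approximants B x g).Nonempty then (ofLex h.some).coeff g else 0

theorem limitCoeff_eq
    (hB : IsImmediateExtension (naturalRing (HahnField G)) B) {x : L} {g h : G}
    {y : HahnField G} (hy : y ∈ approximants B x g) (hh : h ≤ g) :
    limitCoeff B x h = (ofLex y).coeff h := by
  have hy' := approximants_anti hB hh hy
  have hne : (approximants B x h).Nonempty := ⟨y, hy'⟩
  rw [limitCoeff, dif_pos hne]
  exact coeff_eq_of_mem_approximants hB hne.some_mem hy' le_rfl

/-- A descending sequence in the support stays below its first term, where the coefficients are
those of a single genuine Hahn series. -/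
theorem isPWO_support_limitCoeff
    (hB : IsImmediateExtension (naturalRing (HahnField G)) B) (x : L) :
    (Function.support (limitCoeff (G := G) B x)).IsPWO := by
  rw [Set.isPWO_iff_isWF, Set.isWF_iff_no_descending_seq]
  intro f hf hmem
  have hne : (approximants B x (f 0)).Nonempty := by
    by_contra h
    exact hmem 0 (dif_neg h)
  obtain ⟨y, hy⟩ := hne
  refine Set.isWF_iff_no_descending_seq.mp (ofLex y).isWF_support f hf fun n => ?_
  rw [HahnSeries.mem_support, ← limitCoeff_eq hB hy (hf.antitone (Nat.zero_le n))]
  exact hmem n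

theorem isMaximallyValued_hahnField {G : Type u} [AddCommGroup G] [LinearOrder G]
    [IsOrderedAddMonoid G] : IsMaximallyValued.{u, w} (naturalRing (HahnField G)) := by
  intro L _ _ B hB x
  let y : HahnField G := toLex ⟨limitCoeff B x, isPWO_support_limitCoeff hB x⟩
  refine ⟨y, ?_⟩
  by_contra hxy
  have hd : x - algebraMap _ L y ≠ 0 := sub_ne_zero.mpr (Ne.symm hxy)
  -- The equality of value groups provides a monomial `t` with the same value as `x - y`.
  obtain ⟨d, hdv⟩ := hB.value (x - algebraMap _ L y)
  have hd0 : ofLex d ≠ 0 := by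
    rintro h
    have : d = 0 := h
    rw [this, map_zero, map_zero, eq_comm, Valuation.zero_iff] at hdv
    exact hd hdv
  obtain ⟨g, hg⟩ := WithTop.ne_top_iff_exists.mp (orderTop_ne_top.mpr hd0)
  set t : HahnField G := toLex (single g (1 : ℝ)) with ht
  have htv : B.valuation (algebraMap _ L t) = B.valuation (x - algebraMap _ L y) := by
    rw [← hdv]
    apply le_antisymm <;> rw [valuation_algebraMap_le_iff hB, ← hg, ht, ofLex_toLex,
      orderTop_single one_ne_zero]
  have ht0 : algebraMap _ L t ≠ 0 := by
    rw [← B.valuation.ne_zero_iff, htv]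
    exact B.valuation.ne_zero_iff.mpr hd
  have ht1 : 0 < B.valuation (algebraMap _ L t) :=
    zero_lt_iff.mpr (B.valuation.ne_zero_iff.mpr ht0)
  obtain ⟨z, hz⟩ : ∃ z, x - algebraMap _ L y = algebraMap _ L t * z :=
    ⟨(x - algebraMap _ L y) / algebraMap _ L t, by field_simp⟩
  have hzv : B.valuation z = 1 := by
    rw [hz, map_mul] at htv
    exact (mul_eq_left₀ ht1.ne').mp htv.symm
  -- The equality of residue fields provides `r` in `K` with the residue of the unit `z`. Then `y +
  -- t * r` is closer to `x` than `t`, so its coefficient at `g` must already be that of `y`. Hence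
  -- `r` has no constant term, which contradicts `z` being a unit.
  obtain ⟨r, hr, hrv⟩ := hB.residue z (B.mem_of_valuation_le_one z hzv.le)
  have happ : y + t * r ∈ approximants B x g := by
    have e : x - algebraMap _ L (y + t * r) = algebraMap _ L t * (z - algebraMap _ L r) := by
      rw [map_add, map_mul, mul_sub, ← hz]; ring
    change B.valuation (x - algebraMap _ L (y + t * r)) < B.valuation (algebraMap _ L t)
    rw [e, map_mul]
    exact mul_lt_of_lt_one_right ht1 hrv
  have hcoeff : (ofLex r).coeff 0 = 0 := by
    have h1 : (ofLex y).coeff g = (ofLex (y + t * r)).coeff g := limitCoeff_eq hB happ le_rfl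
    rw [ofLex_add, coeff_add, ofLex_single_mul_coeff] at h1
    linarith
  have hr1 : B.valuation (algebraMap _ L r) < 1 := by
    have h1 : B.valuation (algebraMap _ L r) <
        B.valuation (algebraMap (HahnField G) L (toLex (single 0 (1 : ℝ)))) := by
      refine (valuation_algebraMap_lt_single_iff hB).mpr fun h hh => ?_
      rcases hh.eq_or_lt with rfl | hh
      · exact hcoeff
      · exact coeff_eq_zero_of_lt_orderTop
          ((WithTop.coe_lt_coe.mpr hh).trans_le (mem_naturalRing_iff.mp hr))
    have e : (toLex (single 0 (1 : ℝ)) : HahnField G) = 1 := rfl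
    rwa [e, map_one, map_one] at h1
  have := B.valuation.map_add_lt hrv hr1
  rw [sub_add_cancel, hzv] at this
  exact lt_irrefl _ this

end Maximal

/-! ### The principal difference rank of the Hahn field over a concatenation of copies of `ℚ` -/

section Shift

variable (τ : Type u) [LinearOrder τ]

/-- The automorphism of the Hahn group that is induced by the shift of the chain. -/
noncomputable def groupShift : HahnGroup (RatChain τ) ≃+o HahnGroup (RatChain τ) :=
  hahnGroupCongr (ratChainShift τ)

/-- The automorphism of the Hahn field that is induced by the shift of the chain. -/
noncomputable def fieldShift :
    HahnField (HahnGroup (RatChain τ)) ≃+*o HahnField (HahnGroup (RatChain τ)) :=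
  hahnFieldCongr (groupShift τ)

variable {τ}

theorem coeff_groupShift (g : HahnGroup (RatChain τ)) (γ : RatChain τ) :
    (ofLex (groupShift τ g)).coeff (ratChainShift τ γ) = (ofLex g).coeff γ :=
  coeff_hahnGroupCongr _ _ _

theorem orderTop_groupShift (g : HahnGroup (RatChain τ)) :
    (ofLex (groupShift τ g)).orderTop = (ofLex g).orderTop.map (ratChainShift τ) :=
  orderTop_hahnGroupCongr _ _

theorem ratChainShift_lt (γ : RatChain τ) : ratChainShift τ γ < γ :=
  Prod.Lex.lt_iff.mpr (Or.inr ⟨rfl, sub_one_lt _⟩)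

theorem groupShift_neg_iff {g : HahnGroup (RatChain τ)} : groupShift τ g < 0 ↔ g < 0 := by
  rw [← map_lt_map_iff (groupShift τ) (a := g), map_zero]

theorem groupShift_lt_nsmul {g : HahnGroup (RatChain τ)} (hg : g < 0) (n : ℕ) :
    groupShift τ g < n • g := by
  refine neg_lt_of_orderTop_lt (groupShift_neg_iff.mpr hg) ?_
  -- Only an inequality of orders is available, since `n` may be `0`.
  refine lt_of_lt_of_le ?_ (orderTop_le_orderTop_smul n (ofLex g))
  obtain ⟨γ, hγ⟩ := WithTop.ne_top_iff_exists.mp (orderTop_ne_top.mpr (show ofLex g ≠ 0 from hg.ne))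
  rw [orderTop_groupShift, ← hγ, WithTop.map_coe]
  exact WithTop.coe_lt_coe.mpr (ratChainShift_lt γ)

theorem isOmegaIncreasing_fieldShift : IsOmegaIncreasing (fieldShift τ) := by
  intro n a ha
  obtain ⟨g, hg, hg0⟩ := exists_orderTop_eq_of_mem_posInfinite ha
  have h : (ofLex (fieldShift τ a)).orderTop < (ofLex (a ^ n)).orderTop := by
    refine lt_of_lt_of_le ?_ (orderTop_nsmul_le_orderTop_pow (x := ofLex a))
    rw [fieldShift, orderTop_hahnFieldCongr, hg, WithTop.map_coe, ← WithTop.coe_nsmul]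
    exact WithTop.coe_lt_coe.mpr (groupShift_lt_nsmul hg0 n)
  have hpos : 0 < fieldShift τ a := by
    rw [← map_zero (fieldShift τ)]
    exact (map_lt_map_iff (fieldShift τ)).mpr ha.1
  have := abs_lt_abs_of_orderTop_ofLex h
  rw [abs_of_pos hpos] at this
  exact (le_abs_self _).trans_lt this

/-- The elements of the Hahn group that are supported on the copies of `ℚ` with index at most `x`
in `τ`. -/
def initialSubgroup (x : τ) : AddSubgroup (HahnGroup (RatChain τ)) where
  carrier := {g | ∀ γ : RatChain τ, (ofLex γ).1 < OrderDual.toDual x → (ofLex g).coeff γ = 0}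
  zero_mem' _ _ := rfl
  add_mem' {g h} hg hh γ hγ := by
    rw [ofLex_add, coeff_add, hg γ hγ, hh γ hγ, add_zero]
  neg_mem' {g} hg γ hγ := by
    rw [ofLex_neg, coeff_neg, hg γ hγ, neg_zero]

theorem mem_initialSubgroup {x : τ} {g : HahnGroup (RatChain τ)} :
    g ∈ initialSubgroup x ↔
      ∀ γ : RatChain τ, (ofLex γ).1 < OrderDual.toDual x → (ofLex g).coeff γ = 0 :=
  Iff.rfl

theorem mem_initialSubgroup_iff_forall_mem_support {x : τ} {g : HahnGroup (RatChain τ)} :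
    g ∈ initialSubgroup x ↔
      ∀ γ ∈ (ofLex g).support, OrderDual.toDual x ≤ (ofLex γ).1 := by
  rw [mem_initialSubgroup]
  refine forall_congr' fun γ => ?_
  rw [HahnSeries.mem_support, ← not_lt, not_imp_not]

theorem groupShift_mem_initialSubgroup_iff {x : τ} {g : HahnGroup (RatChain τ)} :
    groupShift τ g ∈ initialSubgroup x ↔ g ∈ initialSubgroup x := by
  rw [mem_initialSubgroup, mem_initialSubgroup, (ratChainShift τ).surjective.forall]
  refine forall_congr' fun γ => ?_
  rw [coeff_groupShift]
  rfl

theorem mem_initialSubgroup_of_orderTop_eq {γ : RatChain τ} {g : HahnGroup (RatChain τ)}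
    (h : (ofLex g).orderTop = γ) : g ∈ initialSubgroup (OrderDual.ofDual (ofLex γ).1) := by
  intro δ hδ
  refine coeff_eq_zero_of_lt_orderTop ?_
  rw [h]
  exact WithTop.coe_lt_coe.mpr (Prod.Lex.lt_iff.mpr (Or.inl hδ))

theorem initialSubgroup_mono {x y : τ} (h : x ≤ y) : initialSubgroup x ≤ initialSubgroup y :=
  fun _ hg γ hγ => hg γ (lt_of_lt_of_le hγ (OrderDual.toDual_le_toDual.mpr h))

/-- The element `-1_{(x, 0)}` of the Hahn group. -/
noncomputable def negUnit (x : τ) : HahnGroup (RatChain τ) :=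
  toLex (single (toLex (OrderDual.toDual x, (0 : ℚ)) : RatChain τ) (-1 : ℝ))

theorem negUnit_neg (x : τ) : negUnit x < 0 := by
  rw [← leadingCoeff_neg_iff, negUnit, ofLex_toLex, leadingCoeff_of_single]
  norm_num

theorem orderTop_negUnit (x : τ) : (ofLex (negUnit x)).orderTop =
    ((toLex (OrderDual.toDual x, (0 : ℚ)) : RatChain τ) : WithTop (RatChain τ)) :=
  orderTop_single (by norm_num)

theorem negUnit_mem_initialSubgroup (x : τ) : negUnit x ∈ initialSubgroup x :=
  mem_initialSubgroup_of_orderTop_eq (orderTop_negUnit x)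

/-- If `y < x`, every element of the subgroup of `y` has its support after the whole copy of index
`x`, so none lies below `negUnit x`, and the monomial with that exponent separates the rings. -/
theorem ringOfSubgroup_initialSubgroup_le_iff {x y : τ} :
    ringOfSubgroup (initialSubgroup x) ≤ ringOfSubgroup (initialSubgroup y) ↔ x ≤ y := by
  constructor
  · intro h
    by_contra! hxy
    obtain ⟨k, hk, hkx⟩ := single_mem_ringOfSubgroup_iff.mp
      (h (single_mem_ringOfSubgroup_iff.mpr ⟨_, negUnit_mem_initialSubgroup x, le_rfl⟩))
    refine hkx.not_gt (neg_lt_of_orderTop_lt (negUnit_neg x) ?_)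
    rw [orderTop_negUnit]
    by_contra! hle
    obtain ⟨γ, hγ⟩ := WithTop.ne_top_iff_exists.mp (hle.trans_lt (WithTop.coe_lt_top _)).ne
    rw [← hγ] at hle
    have h1 := Prod.Lex.monotone_fst _ _ (WithTop.coe_le_coe.mp hle)
    have h2 := mem_initialSubgroup_iff_forall_mem_support.mp hk γ (coeff_orderTop_ne hγ.symm)
    exact hxy.not_ge (OrderDual.toDual_le_toDual.mp (h2.trans h1))
  · rintro h s ⟨k, hk, hs⟩
    exact ⟨k, initialSubgroup_mono h hk, hs⟩

theorem ringOfSubgroup_initialSubgroup_mem_differenceRank (x : τ) :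
    ringOfSubgroup (initialSubgroup x) ∈ differenceRank (fieldShift τ) :=
  ⟨ringOfSubgroup_mem_convexRank (negUnit_neg x) (negUnit_mem_initialSubgroup x),
    isDifferenceCompatible_ringOfSubgroup fun _ => groupShift_mem_initialSubgroup_iff⟩

/-- The `n`-fold shift of an infinite element has leading exponent in the `n`-fold shift of the
given point of the chain. -/
theorem exists_mem_orderTop_eq_sub_natCast
    {B : ValuationSubring (HahnField (HahnGroup (RatChain τ)))}
    (hB : IsDifferenceCompatible (fieldShift τ) B)
    {a : HahnField (HahnGroup (RatChain τ))} (ha : a ∈ B) {g : HahnGroup (RatChain τ)}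
    (hg : (ofLex a).orderTop = g) (hg0 : g < 0) {γ : RatChain τ} (hγ : (ofLex g).orderTop = γ)
    (n : ℕ) : ∃ b ∈ B, ∃ h : HahnGroup (RatChain τ), (ofLex b).orderTop = h ∧ h < 0 ∧
      (ofLex h).orderTop = (toLex ((ofLex γ).1, (ofLex γ).2 - n) : RatChain τ) := by
  induction n with
  | zero => exact ⟨a, ha, g, hg, hg0, by simpa using hγ⟩
  | succ n ih =>
    obtain ⟨b, hb, h, hbh, hh0, hh⟩ := ih
    refine ⟨fieldShift τ b, (hB.mem_iff b).mpr hb, groupShift τ h, ?_,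
      groupShift_neg_iff.mpr hh0, ?_⟩
    · rw [fieldShift, orderTop_hahnFieldCongr, hbh, WithTop.map_coe]
    · rw [orderTop_groupShift, hh, WithTop.map_coe]
      simp [ratChainShift, sub_sub]

theorem isLeast_ringOfSubgroup_initialSubgroup {a : HahnField (HahnGroup (RatChain τ))}
    {g : HahnGroup (RatChain τ)} (hg : (ofLex a).orderTop = g) (hg0 : g < 0) {γ : RatChain τ}
    (hγ : (ofLex g).orderTop = γ) :
    IsLeast {B | B ∈ differenceRank (fieldShift τ) ∧ a ∈ B}
      (ringOfSubgroup (initialSubgroup (OrderDual.ofDual (ofLex γ).1))) := by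
  refine ⟨⟨ringOfSubgroup_initialSubgroup_mem_differenceRank _, g,
    mem_initialSubgroup_of_orderTop_eq hγ, hg.ge⟩, ?_⟩
  rintro B ⟨⟨⟨hconv, -⟩, hcomp⟩, haB⟩ s ⟨k, hk, hks⟩
  -- If `k` leads in the same copy as `g`, enough unit shifts pass its leading point; if it leads in
  -- a later copy or vanishes, any `n` works.
  obtain ⟨n, hn⟩ : ∃ n : ℕ, ((toLex ((ofLex γ).1, (ofLex γ).2 - n) : RatChain τ) :
      WithTop (RatChain τ)) < (ofLex k).orderTop := by
    rcases eq_or_ne (ofLex k).orderTop ⊤ with h | h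
    · exact ⟨0, h ▸ WithTop.coe_lt_top _⟩
    · obtain ⟨δ, hδ⟩ := WithTop.ne_top_iff_exists.mp h
      obtain ⟨n, hn⟩ := exists_nat_gt ((ofLex γ).2 - (ofLex δ).2)
      refine ⟨n, ?_⟩
      rw [← hδ]
      have h1 : (ofLex γ).1 ≤ (ofLex δ).1 :=
        mem_initialSubgroup_iff_forall_mem_support.mp hk δ (coeff_orderTop_ne hδ.symm)
      refine WithTop.coe_lt_coe.mpr (Prod.Lex.lt_iff.mpr ?_)
      rcases h1.lt_or_eq with h1 | h1
      · exact Or.inl h1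
      · exact Or.inr ⟨h1, show (ofLex γ).2 - n < (ofLex δ).2 by linarith⟩
  -- The order `h` of the shifted element `b` is negative and dominates `k`, so `h < k` and `|s| <
  -- |b|`; convexity of `B` then captures `s`.
  obtain ⟨b, hb, h, hbh, hh0, hh⟩ := exists_mem_orderTop_eq_sub_natCast hcomp haB hg hg0 hγ n
  have hlt : |s| < |b| := by
    refine abs_lt_abs_of_orderTop_ofLex (lt_of_lt_of_le ?_ hks)
    rw [hbh]
    exact WithTop.coe_lt_coe.mpr (neg_lt_of_orderTop_lt hh0 (hh ▸ hn))
  have habs : |b| ∈ B := by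
    rcases abs_choice b with e | e <;> rw [e]
    exacts [hb, B.neg_mem b hb]
  exact hconv.out (B.neg_mem _ habs) habs (abs_le.mp hlt.le)

theorem ringOfSubgroup_initialSubgroup_mem_principalDifferenceRank (x : τ) :
    ringOfSubgroup (initialSubgroup x) ∈ principalDifferenceRank (fieldShift τ) :=
  ⟨_, single_mem_posInfinite (negUnit_neg x), isLeast_ringOfSubgroup_initialSubgroup
    (orderTop_single one_ne_zero) (negUnit_neg x) (orderTop_negUnit x)⟩

theorem exists_eq_of_mem_principalDifferenceRank
    {A : ValuationSubring (HahnField (HahnGroup (RatChain τ)))}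
    (hA : A ∈ principalDifferenceRank (fieldShift τ)) :
    ∃ x : τ, ringOfSubgroup (initialSubgroup x) = A := by
  obtain ⟨a, ha, hleast⟩ := hA
  obtain ⟨g, hg, hg0⟩ := exists_orderTop_eq_of_mem_posInfinite ha
  obtain ⟨γ, hγ⟩ := WithTop.ne_top_iff_exists.mp
    (orderTop_ne_top.mpr (show ofLex g ≠ 0 from hg0.ne))
  exact ⟨_, (isLeast_ringOfSubgroup_initialSubgroup hg hg0 hγ.symm).unique hleast⟩

/-- The principal difference rank is isomorphic to the chain of indices. -/
noncomputable def principalDifferenceRankIso :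
    τ ≃o principalDifferenceRank (fieldShift τ) :=
  StrictMono.orderIsoOfSurjective
    (fun x => ⟨_, ringOfSubgroup_initialSubgroup_mem_principalDifferenceRank x⟩)
    (strictMono_of_le_iff_le fun _ _ => ringOfSubgroup_initialSubgroup_le_iff.symm)
    (fun A => (exists_eq_of_mem_principalDifferenceRank A.2).imp fun _ h => Subtype.ext h)

theorem not_archimedean_of_mem_posInfinite {K : Type*} [Field K] [LinearOrder K]
    [IsStrictOrderedRing K] {a : K} (ha : a ∈ posInfinite K) : ¬ Archimedean K := by
  intro _
  obtain ⟨n, hn⟩ := exists_nat_ge a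
  exact ha.2 ⟨0, n, by simpa using ha.1.le, by simpa using hn⟩

theorem IsOmegaIncreasing.ne_refl {K : Type*} [Field K] [LinearOrder K] [IsStrictOrderedRing K]
    {σ : K ≃+*o K} (h : IsOmegaIncreasing σ) {a : K} (ha : a ∈ posInfinite K) :
    σ ≠ OrderRingIso.refl K := by
  rintro rfl
  simpa using h 1 a ha

end Shift

theorem corollary4p5 (τ : Type u) [LinearOrder τ] :
    ∃ (σG : HahnGroup (RatChain τ) ≃+o HahnGroup (RatChain τ))
      (σ : HahnField (HahnGroup (RatChain τ)) ≃+*o HahnField (HahnGroup (RatChain τ))),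
      (∀ (g : HahnGroup (RatChain τ)) (γ : RatChain τ),
        (ofLex (σG g)).coeff (ratChainShift τ γ) = (ofLex g).coeff γ) ∧
      (∀ (s : HahnField (HahnGroup (RatChain τ))) (g : HahnGroup (RatChain τ)),
        (ofLex (σ s)).coeff (σG g) = (ofLex s).coeff g) ∧
      IsMaximallyValued.{u, w} (naturalRing (HahnField (HahnGroup (RatChain τ)))) ∧
      IsOmegaIncreasing σ ∧
      Nonempty (principalDifferenceRank σ ≃o τ) ∧
      (Nonempty τ →
        ¬ Archimedean (HahnField (HahnGroup (RatChain τ))) ∧ σ ≠ OrderRingIso.refl _) := by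
  refine ⟨groupShift τ, fieldShift τ, coeff_groupShift, coeff_hahnFieldCongr _,
    isMaximallyValued_hahnField, isOmegaIncreasing_fieldShift,
    ⟨principalDifferenceRankIso.symm⟩, ?_⟩
  rintro ⟨x⟩
  have hx := single_mem_posInfinite (negUnit_neg x)
  exact ⟨not_archimedean_of_mem_posInfinite hx, isOmegaIncreasing_fieldShift.ne_refl hx⟩
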